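/- For a prime power $q$ and $n\ge 0$, let $G_q$ be the $q\times q$ Reed--Solomon kernel over $\mathbb F_q$: its columns are indexed by the elements $x\in\mathbb F_q$ and its row $i\in\{0,\dots,q-1\}$ is $(x^{q-1-i})_{x\in\mathbb F_q}$ (with $0^0=1$). The $q$-ary polar transform of length $N=q^n$ maps $u\in\mathbb F_q^N$ to $uG_q^{\otimes n}$. The codeword is sent over the $q$-ary erasure channel (QEC) with erasure probability $\epsilon$, which erases each code symbol independently with probability $\epsilon$. For $0\le i<N$ the $i$-th effective channel has input $u_i$ and output the received word together with $u_0,\dots,u_{i-1}$; its erasure rate is the probability, for uniformly distributed $u$, that this output does not determine $u_i$. **Corollary.** Let $\epsilon\in[0,1]$. For any $\gamma>0$ and $\delta>0$, there are $\beta\in(0,\frac12]$ and $q_0$ such that, for all prime powers $q\ge q_0$ and all $n\ge 0$, with $N=q^n$, the fraction of the $N$ effective channels whose erasure rate is at most $N^{-\gamma}$ is at least $$1-\epsilon-5N^{-\frac12+\delta}.$$ In particular this fraction is at least $1-\epsilon-O(N^{-1/2+\delta})$. (The number $\beta$ does not occur in the conclusion.) -/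

import Mathlib

noncomputable section

namespace RSPolar

variable (F : Type*) [Field F] [Fintype F]

/-- Positions of the input symbols of a length `q ^ n` polar code, `q = |F|`: the base-`q` digits
`(i₀, …, i_{n-1})` of a number in `{0, …, q ^ n - 1}`, most significant digit first.
The lexicographic order on them is the usual order of numbers. -/
abbrev Idx (n : ℕ) : Type := Fin n → Fin (Fintype.card F)

/-- Positions of the code symbols. The columns of the kernel are labelled by the `q` evaluation
points, so a code position is an `n`-tuple of field elements. -/
abbrev Pos (n : ℕ) : Type _ := Fin n → F

/-- The `q × q` Reed–Solomon kernel: row `i` (for `i = 0, …, q - 1`) is the evaluation of the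
monomial `x ^ (q - 1 - i)` at all the elements of `F`; the last row is the all-one vector. -/
def kernel : Matrix (Fin (Fintype.card F)) F F :=
  fun i x => x ^ (Fintype.card F - 1 - (i : ℕ))

/-- The polar transform, i.e. the `n`-fold Kronecker power of the kernel. -/
def transform (n : ℕ) : Matrix (Idx F n) (Pos F n) F :=
  fun i k => ∏ t, kernel F (i t) (k t)

variable {F}

/-- The codeword of the input vector `u`. -/
def encode {n : ℕ} (u : Idx F n → F) : Pos F n → F :=
  Matrix.vecMul u (transform F n)

open Classical in
/-- The word received when `x` is sent and exactly the positions in `E` are erased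
(`none` is the erasure symbol). -/
def receive {n : ℕ} (E : Finset (Pos F n)) (x : Pos F n → F) : Pos F n → Option F :=
  fun k => if k ∈ E then none else some (x k)

/-- The `i`-th effective channel has input `u i` and output the received word together with the
previous input symbols `u j`, `j < i` (the later input symbols being unknown). When `u` is sent
with erasure pattern `E`, its output is an erasure if it does not determine `u i`: some other
input vector gives the same output but has a different `i`-th symbol. -/
def IsErased {n : ℕ} (u : Idx F n → F) (E : Finset (Pos F n)) (i : Idx F n) : Prop :=
  ∃ v : Idx F n → F, (∀ j, toLex j < toLex i → v j = u j) ∧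
    receive E (encode v) = receive E (encode u) ∧ v i ≠ u i

variable (F)

/-- The probability that the memoryless `q`-ary erasure channel with erasure probability `ε`
erases exactly the positions in `E`. -/
def patternProb (ε : ℝ) {n : ℕ} (E : Finset (Pos F n)) : ℝ :=
  ε ^ E.card * (1 - ε) ^ (Fintype.card F ^ n - E.card)

open Classical in
/-- The erasure rate of the `i`-th effective channel after `n` polarization steps: the probability
of an erasure at its output, for a uniformly random input vector sent over the `q`-ary erasure
channel with erasure probability `ε`. -/
def erasureRate (ε : ℝ) (n : ℕ) (i : Idx F n) : ℝ :=
  (∑ u : Idx F n → F, ∑ E : Finset (Pos F n), if IsErased u E i then patternProb F ε E else 0) /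
    (Fintype.card (Idx F n → F) : ℝ)

open Classical in
/-- The fraction of the `q ^ n` effective channels whose erasure rate is at most `η`. -/
def fractionAtMost (ε : ℝ) (n : ℕ) (η : ℝ) : ℝ :=
  ((Finset.univ.filter fun i : Idx F n => erasureRate F ε n i ≤ η).card : ℝ) /
    (Fintype.card F : ℝ) ^ n

end RSPolar

end

open Finset

namespace RSPolar

/-! Row `m` of the kernel and the rows after it generate a code of polynomials of degree at most `q
- 1 - m`, so row `m` can be decoded whenever at most `m` of the `q` symbols are erased. One step
thus replaces the erasure probability `x` by at most P(Bin(q, x) > m). Iterating over the digits of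
`i` gives `tailProcess`, an upper bound for the erasure rate (`erasureRate_le_tailProcess`).

Averaged over `m`, the tails have mean `x`, so the process conserves the mean (`sum_tailProcess`).
As a function of `m`, the tail drops from near 1 to near 0 in a window of width about √(qx), so the
sum over `m` of the potential `(x(1-x))^β` grows by at most a factor `C * q^(1/2)`
(`exists_sum_potential_binomialTail_le`). Once `q` is so large that `C ≤ q^(δ/2)`, the mean
potential after `n` steps is at most `N^(-1/2+δ/2)`.

A channel whose bound `z` exceeds `η = N^(-γ)` satisfies `1 ≤ z + η^(-β) * potential β z`. Averaging
leaves a fraction of at most `ε + N^(γβ) * N^(-1/2+δ/2)` for such channels, and `β` is chosen so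
that `γβ ≤ δ/2`. -/

/-! ### Binomial tails: identities and exponential bounds. -/

/-- The probability that a binomial random variable with parameters `q` and `x` equals `k`. -/
noncomputable def binomialWeight (q k : ℕ) (x : ℝ) : ℝ :=
  q.choose k * (x ^ k * (1 - x) ^ (q - k))

/-- The probability that a binomial random variable with parameters `q` and `x` exceeds `m`. -/
noncomputable def binomialTail (q m : ℕ) (x : ℝ) : ℝ :=
  ∑ k ∈ range (q + 1), if m < k then binomialWeight q k x else 0

theorem binomialWeight_nonneg (q k : ℕ) {x : ℝ} (h0 : 0 ≤ x) (h1 : x ≤ 1) :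
    0 ≤ binomialWeight q k x := by
  have : 0 ≤ 1 - x := by linarith
  unfold binomialWeight
  positivity

theorem sum_binomialWeight_mul_pow (q : ℕ) (x g : ℝ) :
    ∑ k ∈ range (q + 1), binomialWeight q k x * g ^ k = (1 + x * (g - 1)) ^ q := by
  have h : 1 + x * (g - 1) = x * g + (1 - x) := by ring
  rw [h, add_pow]
  refine sum_congr rfl fun k _ => ?_
  rw [binomialWeight, mul_pow]
  ring

theorem sum_binomialWeight (q : ℕ) (x : ℝ) :
    ∑ k ∈ range (q + 1), binomialWeight q k x = 1 := by
  simpa using sum_binomialWeight_mul_pow q x 1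

theorem sum_mul_binomialWeight (q : ℕ) (x : ℝ) :
    ∑ k ∈ range (q + 1), (k : ℝ) * binomialWeight q k x = q * x := by
  have h := congrArg (Polynomial.eval x) (bernsteinPolynomial.sum_smul ℝ q)
  simp only [Polynomial.eval_finsetSum, nsmul_eq_mul, Polynomial.eval_mul, Polynomial.eval_natCast,
    Polynomial.eval_X, bernsteinPolynomial, Polynomial.eval_pow, Polynomial.eval_sub,
    Polynomial.eval_one] at h
  rw [← h]
  refine sum_congr rfl fun k _ => ?_
  rw [binomialWeight]
  ring

theorem one_sub_binomialTail (q m : ℕ) (x : ℝ) :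
    1 - binomialTail q m x =
      ∑ k ∈ range (q + 1), if k ≤ m then binomialWeight q k x else 0 := by
  rw [← sum_binomialWeight q x, binomialTail, ← sum_sub_distrib]
  refine sum_congr rfl fun k _ => ?_
  by_cases h : m < k
  · simp [h]
  · simp [h, not_lt.1 h]

theorem binomialTail_nonneg (q m : ℕ) {x : ℝ} (h0 : 0 ≤ x) (h1 : x ≤ 1) :
    0 ≤ binomialTail q m x :=
  sum_nonneg fun k _ => by
    split_ifs
    exacts [binomialWeight_nonneg q k h0 h1, le_rfl]

theorem binomialTail_le_one (q m : ℕ) {x : ℝ} (h0 : 0 ≤ x) (h1 : x ≤ 1) :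
    binomialTail q m x ≤ 1 := by
  rw [← sub_nonneg, one_sub_binomialTail]
  exact sum_nonneg fun k _ => by
    split_ifs
    exacts [binomialWeight_nonneg q k h0 h1, le_rfl]

theorem binomialWeight_symm {q k : ℕ} (hk : k ≤ q) (x : ℝ) :
    binomialWeight q (q - k) (1 - x) = binomialWeight q k x := by
  rw [binomialWeight, binomialWeight, Nat.choose_symm hk, Nat.sub_sub_self hk, sub_sub_cancel]
  ring

/-- Exchange successes and failures: more than `q - 1 - m` failures means at most `m` successes.
This reduces the contraction estimate to `x ≤ 1/2`. -/
theorem binomialTail_symm {q m : ℕ} (hm : m < q) (x : ℝ) :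
    binomialTail q (q - 1 - m) (1 - x) = 1 - binomialTail q m x := by
  rw [one_sub_binomialTail, binomialTail, ← sum_range_reflect]
  refine sum_congr rfl fun k hk => ?_
  have hk : k ≤ q := Nat.lt_succ_iff.1 (mem_range.1 hk)
  rw [Nat.add_sub_cancel, binomialWeight_symm hk]
  exact if_congr (by omega) rfl rfl

/-- The mean of the tails of a binomial variable is its expectation. -/
theorem sum_binomialTail (q : ℕ) (x : ℝ) :
    ∑ m ∈ range q, binomialTail q m x = q * x := by
  rw [← sum_mul_binomialWeight]
  unfold binomialTail
  rw [sum_comm]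
  refine sum_congr rfl fun k hk => ?_
  have hk : k ≤ q := Nat.lt_succ_iff.1 (mem_range.1 hk)
  rw [← sum_filter, sum_const, nsmul_eq_mul]
  congr 2
  have : (range q).filter (fun m => m < k) = range k := by
    ext m
    simp only [mem_filter, mem_range]
    omega
  rw [this, card_range]

/-- Markov's inequality for an increasing exponential of a binomial variable. -/
theorem binomialTail_le_exp (q m : ℕ) {x s : ℝ} (h0 : 0 ≤ x) (h1 : x ≤ 1) (hs0 : 0 ≤ s)
    (hs1 : s ≤ 1) :
    binomialTail q m x ≤ Real.exp (q * x * s ^ 2 - s * (m - q * x)) := by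
  have hexp : Real.exp s - 1 ≤ s + s ^ 2 := by
    have := (abs_le.1 (Real.abs_exp_sub_one_sub_id_le (x := s) (by rwa [abs_of_nonneg hs0]))).2
    linarith
  have hg : 1 ≤ Real.exp s := Real.one_le_exp hs0
  calc binomialTail q m x
      ≤ ∑ k ∈ range (q + 1), Real.exp (-(s * m)) * (binomialWeight q k x * Real.exp s ^ k) := by
        refine sum_le_sum fun k _ => ?_
        have hw := binomialWeight_nonneg q k h0 h1
        split_ifs with h
        · have h2 : 1 ≤ Real.exp (-(s * m)) * Real.exp s ^ k := by
            rw [← Real.exp_nat_mul, ← Real.exp_add]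
            refine Real.one_le_exp ?_
            have : (m : ℝ) ≤ k := by exact_mod_cast h.le
            nlinarith
          calc binomialWeight q k x ≤ binomialWeight q k x * _ := le_mul_of_one_le_right hw h2
            _ = _ := by ring
        · positivity
    _ = Real.exp (-(s * m)) * (1 + x * (Real.exp s - 1)) ^ q := by
        rw [← mul_sum, sum_binomialWeight_mul_pow]
    _ ≤ Real.exp (-(s * m)) * Real.exp (x * (s + s ^ 2)) ^ q := by
        have : 0 ≤ x * (Real.exp s - 1) := mul_nonneg h0 (by linarith)
        gcongr
        calc 1 + x * (Real.exp s - 1) ≤ x * (s + s ^ 2) + 1 := by nlinarith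
          _ ≤ _ := Real.add_one_le_exp _
    _ = _ := by
        rw [← Real.exp_nat_mul, ← Real.exp_add]
        congr 1
        ring

/-- Markov's inequality for a decreasing exponential of a binomial variable. -/
theorem one_sub_binomialTail_le_exp (q m : ℕ) {x s : ℝ} (h0 : 0 ≤ x) (h1 : x ≤ 1) (hs0 : 0 ≤ s)
    (hs1 : s ≤ 1) :
    1 - binomialTail q m x ≤ Real.exp (q * x * s ^ 2 + s * (m - q * x)) := by
  have hexp : Real.exp (-s) - 1 ≤ -s + s ^ 2 := by
    have := (abs_le.1 (Real.abs_exp_sub_one_sub_id_le (x := -s)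
      (by rwa [abs_neg, abs_of_nonneg hs0]))).2
    linarith [neg_sq s]
  have hg : 0 < Real.exp (-s) := Real.exp_pos _
  calc 1 - binomialTail q m x
      ≤ ∑ k ∈ range (q + 1), Real.exp (s * m) * (binomialWeight q k x * Real.exp (-s) ^ k) := by
        rw [one_sub_binomialTail]
        refine sum_le_sum fun k _ => ?_
        have hw := binomialWeight_nonneg q k h0 h1
        split_ifs with h
        · have h2 : 1 ≤ Real.exp (s * m) * Real.exp (-s) ^ k := by
            rw [← Real.exp_nat_mul, ← Real.exp_add]
            refine Real.one_le_exp ?_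
            have : (k : ℝ) ≤ m := by exact_mod_cast h
            nlinarith
          calc binomialWeight q k x ≤ binomialWeight q k x * _ := le_mul_of_one_le_right hw h2
            _ = _ := by ring
        · positivity
    _ = Real.exp (s * m) * (1 + x * (Real.exp (-s) - 1)) ^ q := by
        rw [← mul_sum, sum_binomialWeight_mul_pow]
    _ ≤ Real.exp (s * m) * Real.exp (x * (-s + s ^ 2)) ^ q := by
        have : 0 ≤ 1 + x * (Real.exp (-s) - 1) := by nlinarith
        gcongr
        calc 1 + x * (Real.exp (-s) - 1) ≤ x * (-s + s ^ 2) + 1 := by nlinarith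
          _ ≤ _ := Real.add_one_le_exp _
    _ = _ := by
        rw [← Real.exp_nat_mul, ← Real.exp_add]
        congr 1
        ring

/-- For a binomial variable of mean at most one the tails decay geometrically, starting from
the mean. -/
theorem binomialTail_le_of_mean_le_one (q m : ℕ) {x : ℝ} (h0 : 0 ≤ x) (h1 : x ≤ 1)
    (hqx : q * x ≤ 1) : binomialTail q m x ≤ 2 * (q * x) * (1 / 2) ^ m := by
  have hy : (0 : ℝ) ≤ q * x := by positivity
  -- Markov with `2^k - 1` rather than `2^k`: it vanishes at `k = 0`, so the bound is proportional
  -- to the mean `q * x`.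
  calc binomialTail q m x
      ≤ ∑ k ∈ range (q + 1), (1 / 2) ^ m * (binomialWeight q k x * 2 ^ k - binomialWeight q k x) := by
        refine sum_le_sum fun k _ => ?_
        have hw := binomialWeight_nonneg q k h0 h1
        split_ifs with h
        · have h2 : (1 : ℝ) ≤ (1 / 2) ^ m * (2 ^ k - 1) := by
            have h3 : (2 : ℝ) ^ (m + 1) ≤ 2 ^ k := pow_le_pow_right₀ (by norm_num) h
            have h4 : (1 : ℝ) ≤ 2 ^ m := one_le_pow₀ (by norm_num)
            rw [one_div, inv_pow, ← div_eq_inv_mul, le_div_iff₀ (by positivity)]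
            rw [pow_succ] at h3
            linarith
          calc binomialWeight q k x ≤ binomialWeight q k x * _ := le_mul_of_one_le_right hw h2
            _ = _ := by ring
        · have h2 : (1 : ℝ) ≤ 2 ^ k := one_le_pow₀ (by norm_num)
          have : 0 ≤ binomialWeight q k x * 2 ^ k - binomialWeight q k x := by nlinarith
          positivity
    _ = (1 / 2) ^ m * ((1 + x) ^ q - 1) := by
        rw [← mul_sum, sum_sub_distrib, sum_binomialWeight_mul_pow, sum_binomialWeight]
        norm_num
    _ ≤ (1 / 2) ^ m * (2 * (q * x)) := by
        have h2 : (1 + x) ^ q ≤ Real.exp (q * x) := by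
          rw [Real.exp_nat_mul]
          have := Real.add_one_le_exp x
          gcongr
          linarith
        have h3 := (abs_le.1 (Real.abs_exp_sub_one_sub_id_le (x := q * x)
          (by rwa [abs_of_nonneg hy]))).2
        gcongr
        nlinarith
    _ = _ := by ring

/-! ### Contraction of the potential in one step. -/

/-- The potential function that measures how far an erasure probability is from `0` and `1`. -/
noncomputable def potential (β x : ℝ) : ℝ := (x * (1 - x)) ^ β

theorem potential_one_sub (β x : ℝ) : potential β (1 - x) = potential β x := by
  rw [potential, potential, sub_sub_cancel, mul_comm]

theorem potential_nonneg (β : ℝ) {x : ℝ} (h0 : 0 ≤ x) (h1 : x ≤ 1) : 0 ≤ potential β x :=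
  Real.rpow_nonneg (mul_nonneg h0 (by linarith)) _

theorem potential_le_one {β : ℝ} (hβ : 0 ≤ β) {x : ℝ} (h0 : 0 ≤ x) (h1 : x ≤ 1) :
    potential β x ≤ 1 :=
  Real.rpow_le_one (mul_nonneg h0 (by linarith)) (by nlinarith) hβ

theorem sum_range_pow_le {r : ℝ} (h0 : 0 ≤ r) (h1 : r < 1) (n : ℕ) :
    ∑ k ∈ range n, r ^ k ≤ (1 - r)⁻¹ :=
  sum_le_hasSum _ (fun _ _ => pow_nonneg h0 _) (hasSum_geometric_of_lt_one h0 h1)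

/-- Splitting at `⌊y⌋₊` leaves two geometric series of ratio `exp (-a)`, each at most `2 / a`; the
factor `exp a` absorbs the rounding of `y`. -/
theorem sum_range_exp_neg_abs_sub_le {a y : ℝ} (ha0 : 0 < a) (ha1 : a ≤ 1 / 2) (hy : 0 ≤ y)
    (q : ℕ) : ∑ m ∈ range q, Real.exp (-(a * |(m : ℝ) - y|)) ≤ Real.exp a * (4 / a) := by
  set c := ⌊y⌋₊ with hc
  have hc1 : (c : ℝ) ≤ y := Nat.floor_le hy
  have hc2 : y < c + 1 := Nat.lt_floor_add_one y
  set r := Real.exp (-a) with hr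
  have hr0 : 0 ≤ r := (Real.exp_pos _).le
  have hra : a / 2 ≤ 1 - r := by
    have := (abs_le.1 (Real.abs_exp_sub_one_sub_id_le (x := -a)
      (by rw [abs_neg, abs_of_pos ha0]; linarith))).2
    nlinarith
  have hr1 : r < 1 := by linarith
  have hgeom : ∀ n, ∑ k ∈ range n, r ^ k ≤ 2 / a := fun n =>
    (sum_range_pow_le hr0 hr1 n).trans (by
      rw [← inv_div]
      exact inv_anti₀ (by positivity) hra)
  have hpow : ∀ k : ℕ, r ^ k = Real.exp (-(a * k)) := fun k => by
    rw [hr, ← Real.exp_nat_mul]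
    congr 1
    ring
  -- Lengthening the range to `c + q` avoids asking whether `c < q`.
  calc ∑ m ∈ range q, Real.exp (-(a * |(m : ℝ) - y|))
      ≤ ∑ m ∈ range (c + q), Real.exp (-(a * |(m : ℝ) - y|)) :=
        sum_le_sum_of_subset_of_nonneg (range_mono (by omega)) fun _ _ _ => (Real.exp_pos _).le
    _ = ∑ m ∈ range c, Real.exp (-(a * |(m : ℝ) - y|)) +
          ∑ m ∈ range q, Real.exp (-(a * |((c + m : ℕ) : ℝ) - y|)) := sum_range_add _ _ _
    _ ≤ ∑ m ∈ range c, Real.exp a * r ^ (c - 1 - m) + ∑ m ∈ range q, Real.exp a * r ^ m := by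
        refine add_le_add (sum_le_sum fun m hm => ?_) (sum_le_sum fun m _ => ?_)
        · have hm := mem_range.1 hm
          rw [hpow, ← Real.exp_add, Real.exp_le_exp]
          have h1 : ((c - 1 - m : ℕ) : ℝ) = c - 1 - m := by
            rw [Nat.cast_sub (by omega), Nat.cast_sub (by omega), Nat.cast_one]
          rw [h1]
          have := neg_le_abs ((m : ℝ) - y)
          nlinarith
        · rw [hpow, ← Real.exp_add, Real.exp_le_exp, Nat.cast_add]
          have := le_abs_self ((c : ℝ) + m - y)
          nlinarith
    _ = Real.exp a * (∑ m ∈ range c, r ^ m + ∑ m ∈ range q, r ^ m) := by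
        rw [← mul_sum, ← mul_sum, sum_range_reflect (fun m => r ^ m), mul_add]
    _ ≤ Real.exp a * (2 / a + 2 / a) := by
        gcongr <;> exact hgeom _
    _ = _ := by ring

/-- With `s = (q * x)^(-1/2)` the quadratic term of both Markov bounds is 1, so the potential decays
exponentially in `|m - q * x|` on the scale `√(q * x) / β`. -/
theorem sum_potential_binomialTail_le_of_one_le_mean {β : ℝ} (hβ0 : 0 < β) (hβ1 : β ≤ 1 / 2)
    (q : ℕ) {x : ℝ} (h0 : 0 ≤ x) (h1 : x ≤ 1) (hqx : 1 ≤ q * x) :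
    ∑ m ∈ range q, potential β (binomialTail q m x) ≤
      12 / β * (q : ℝ) ^ (1 / 2 : ℝ) * x ^ β := by
  have hx : 0 < x := by
    rcases h0.eq_or_lt with h | h
    · rw [← h] at hqx
      norm_num at hqx
    · exact h
  set y := (q : ℝ) * x with hy
  have hy0 : 0 < y := by linarith
  have hsq : 1 ≤ √y := Real.one_le_sqrt.2 hqx
  set s := (√y)⁻¹ with hs
  have hs0 : 0 < s := by positivity
  have hs1 : s ≤ 1 := inv_le_one_of_one_le₀ hsq
  have hys : y * s ^ 2 = 1 := by
    rw [hs, inv_pow, Real.sq_sqrt hy0.le, mul_inv_cancel₀ hy0.ne']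
  have hterm : ∀ m : ℕ, potential β (binomialTail q m x) ≤
      Real.exp β * Real.exp (-(β * s * |(m : ℝ) - y|)) := fun m => by
    have hf0 := binomialTail_nonneg q m h0 h1
    have hf1 := binomialTail_le_one q m h0 h1
    have hU := binomialTail_le_exp q m h0 h1 hs0.le hs1
    have hL := one_sub_binomialTail_le_exp q m h0 h1 hs0.le hs1
    rw [← hy, hys] at hU hL
    -- Above the mean the tail itself is small, below it its complement; the other factor is at most
    -- 1.
    have hle : binomialTail q m x * (1 - binomialTail q m x) ≤
        Real.exp (1 - s * |(m : ℝ) - y|) := by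
      rcases abs_cases ((m : ℝ) - y) with ⟨h, _⟩ | ⟨h, _⟩
      · rw [h]
        exact (mul_le_of_le_one_right hf0 (by linarith)).trans hU
      · rw [h, mul_neg, sub_neg_eq_add]
        exact (mul_le_of_le_one_left (by linarith) hf1).trans hL
    calc potential β (binomialTail q m x) ≤ Real.exp (1 - s * |(m : ℝ) - y|) ^ β :=
          Real.rpow_le_rpow (mul_nonneg hf0 (by linarith)) hle hβ0.le
      _ = _ := by
          rw [← Real.exp_mul, ← Real.exp_add]
          congr 1
          ring
  have hbs : β * s ≤ 1 / 2 := by nlinarith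
  calc ∑ m ∈ range q, potential β (binomialTail q m x)
      ≤ Real.exp β * ∑ m ∈ range q, Real.exp (-(β * s * |(m : ℝ) - y|)) := by
        rw [mul_sum]
        exact sum_le_sum fun m _ => hterm m
    _ ≤ Real.exp β * (Real.exp (β * s) * (4 / (β * s))) := by
        gcongr
        exact sum_range_exp_neg_abs_sub_le (by positivity) hbs hy0.le q
    _ = Real.exp (β + β * s) * (4 / β) * √y := by
        rw [Real.exp_add, hs]
        field_simp
    _ ≤ 3 * (4 / β) * √y := by
        gcongr
        calc Real.exp (β + β * s) ≤ Real.exp 1 := Real.exp_le_exp.2 (by linarith)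
          _ ≤ 3 := by linarith [Real.exp_one_lt_d9]
    _ = 12 / β * (q : ℝ) ^ (1 / 2 : ℝ) * x ^ (1 / 2 : ℝ) := by
        rw [Real.sqrt_eq_rpow, hy, Real.mul_rpow (by positivity) h0]
        ring
    _ ≤ _ := by
        gcongr 12 / β * (q : ℝ) ^ (1 / 2 : ℝ) * ?_
        exact Real.rpow_le_rpow_of_exponent_ge hx h1 hβ1

/-- Here the window has bounded width: the tails decay geometrically from `q * x`, and so do their
`β`-th powers. The resulting `q^β` is at most `q^(1/2)`. -/
theorem sum_potential_binomialTail_le_of_mean_le_one {β : ℝ} (hβ0 : 0 < β) (hβ1 : β ≤ 1 / 2)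
    {q : ℕ} (hq : 1 ≤ q) {x : ℝ} (h0 : 0 ≤ x) (h1 : x ≤ 1) (hqx : q * x ≤ 1) :
    ∑ m ∈ range q, potential β (binomialTail q m x) ≤
      2 * (1 - (1 / 2 : ℝ) ^ β)⁻¹ * (q : ℝ) ^ (1 / 2 : ℝ) * x ^ β := by
  have hr0 : (0 : ℝ) ≤ (1 / 2 : ℝ) ^ β := by positivity
  have hr1 : (1 / 2 : ℝ) ^ β < 1 := Real.rpow_lt_one (by norm_num) (by norm_num) hβ0
  have hq' : (1 : ℝ) ≤ q := by exact_mod_cast hq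
  have hterm : ∀ m : ℕ, potential β (binomialTail q m x) ≤
      2 ^ β * ((q : ℝ) ^ β * x ^ β) * ((1 / 2 : ℝ) ^ β) ^ m := fun m => by
    have hf0 := binomialTail_nonneg q m h0 h1
    have hf1 := binomialTail_le_one q m h0 h1
    calc potential β (binomialTail q m x) ≤ (2 * (q * x) * (1 / 2) ^ m) ^ β :=
          Real.rpow_le_rpow (mul_nonneg hf0 (by linarith))
            ((mul_le_of_le_one_right hf0 (by linarith)).trans
              (binomialTail_le_of_mean_le_one q m h0 h1 hqx)) hβ0.le
      _ = _ := by
          rw [Real.mul_rpow (by positivity) (by positivity),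
            Real.mul_rpow (by positivity) (by positivity), Real.mul_rpow (by positivity) h0,
            ← Real.rpow_natCast, ← Real.rpow_natCast, ← Real.rpow_mul (by norm_num),
            ← Real.rpow_mul (by norm_num), mul_comm (m : ℝ)]
  have h2 : (2 : ℝ) ^ β ≤ 2 := by
    simpa using Real.rpow_le_rpow_of_exponent_le (x := 2) (by norm_num)
      (show β ≤ 1 by linarith)
  have h3 : (q : ℝ) ^ β ≤ (q : ℝ) ^ (1 / 2 : ℝ) := Real.rpow_le_rpow_of_exponent_le hq' hβ1
  have h4 : 0 ≤ (1 - (1 / 2 : ℝ) ^ β)⁻¹ := inv_nonneg.2 (by linarith)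
  calc ∑ m ∈ range q, potential β (binomialTail q m x)
      ≤ 2 ^ β * ((q : ℝ) ^ β * x ^ β) * ∑ m ∈ range q, ((1 / 2 : ℝ) ^ β) ^ m := by
        rw [mul_sum]
        exact sum_le_sum fun m _ => hterm m
    _ ≤ 2 * ((q : ℝ) ^ (1 / 2 : ℝ) * x ^ β) * (1 - (1 / 2 : ℝ) ^ β)⁻¹ := by
        gcongr
        exact sum_range_pow_le hr0 hr1 q
    _ = _ := by ring

/-- One polarization step shrinks the mean of the potential by a factor of order `q ^ (-1/2)`. -/
theorem exists_sum_potential_binomialTail_le {β : ℝ} (hβ0 : 0 < β) (hβ1 : β ≤ 1 / 2) :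
    ∃ C : ℝ, 0 < C ∧ ∀ q : ℕ, 1 ≤ q → ∀ x : ℝ, 0 ≤ x → x ≤ 1 →
      ∑ m ∈ range q, potential β (binomialTail q m x) ≤
        C * (q : ℝ) ^ (1 / 2 : ℝ) * potential β x := by
  have hr1 : (1 / 2 : ℝ) ^ β < 1 := Real.rpow_lt_one (by norm_num) (by norm_num) hβ0
  set D := max (12 / β) (2 * (1 - (1 / 2 : ℝ) ^ β)⁻¹) with hD
  have hD0 : 0 < D := lt_max_of_lt_left (by positivity)
  have hhalf : ∀ q : ℕ, 1 ≤ q → ∀ x : ℝ, 0 ≤ x → x ≤ 1 / 2 →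
      ∑ m ∈ range q, potential β (binomialTail q m x) ≤
        2 * D * (q : ℝ) ^ (1 / 2 : ℝ) * potential β x := fun q hq x h0 h1 => by
    have hx1 : x ≤ 1 := by linarith
    -- For `x ≤ 1/2` one has `(1 - x)^β ≥ 1 - x ≥ 1/2`.
    have hpot : x ^ β ≤ 2 * potential β x := by
      have h2 : (1 : ℝ) ≤ 2 * (1 - x) ^ β := by
        have h3 : (1 - x) ^ (1 : ℝ) ≤ (1 - x) ^ β :=
          Real.rpow_le_rpow_of_exponent_ge (by linarith) (by linarith) (by linarith)
        rw [Real.rpow_one] at h3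
        linarith
      rw [potential, Real.mul_rpow h0 (by linarith)]
      have := Real.rpow_nonneg h0 β
      nlinarith
    calc ∑ m ∈ range q, potential β (binomialTail q m x)
        ≤ D * (q : ℝ) ^ (1 / 2 : ℝ) * x ^ β := by
          rcases le_total 1 ((q : ℝ) * x) with h | h
          · refine (sum_potential_binomialTail_le_of_one_le_mean hβ0 hβ1 q h0 hx1 h).trans ?_
            gcongr
            exact le_max_left _ _
          · refine (sum_potential_binomialTail_le_of_mean_le_one hβ0 hβ1 hq h0 hx1 h).trans ?_
            gcongr
            exact le_max_right _ _
      _ ≤ D * (q : ℝ) ^ (1 / 2 : ℝ) * (2 * potential β x) := by gcongr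
      _ = _ := by ring
  refine ⟨2 * D, by positivity, fun q hq x h0 h1 => ?_⟩
  rcases le_total x (1 / 2) with h | h
  · exact hhalf q hq x h0 h
  · have := hhalf q hq (1 - x) (by linarith) (by linarith)
    rw [potential_one_sub, ← sum_range_reflect] at this
    refine le_of_eq_of_le (sum_congr rfl fun m hm => ?_) this
    rw [binomialTail_symm (mem_range.1 hm), potential_one_sub]

/-! ### Linearity and the recursive structure of the code. -/

/-- For a linear code, the input symbol `i` is ambiguous iff some input vector vanishing before `i`
but not at `i` has a codeword supported on the erased positions. -/
theorem isErased_iff {F : Type*} [Field F] [Fintype F] {n : ℕ} (u : Idx F n → F)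
    (E : Finset (Pos F n)) (i : Idx F n) :
    IsErased u E i ↔ ∃ v : Idx F n → F, (∀ j, toLex j < toLex i → v j = 0) ∧
      (∀ k, k ∉ E → encode v k = 0) ∧ v i ≠ 0 := by
  have hrec : ∀ x y : Pos F n → F, receive E x = receive E y ↔ ∀ k, k ∉ E → x k = y k := by
    intro x y
    rw [funext_iff]
    refine forall_congr' fun k => ?_
    by_cases h : k ∈ E <;> simp [receive, h]
  constructor
  · rintro ⟨v, h1, h2, h3⟩
    refine ⟨v - u, fun j hj => sub_eq_zero.2 (h1 j hj), fun k hk => ?_, sub_ne_zero.2 h3⟩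
    rw [encode, Matrix.sub_vecMul]
    exact sub_eq_zero.2 ((hrec _ _).1 h2 k hk)
  · rintro ⟨v, h1, h2, h3⟩
    refine ⟨u + v, fun j hj => by simp [h1 j hj], (hrec _ _).2 fun k hk => ?_, by simpa using h3⟩
    rw [encode, Matrix.add_vecMul, Pi.add_apply]
    exact add_eq_left.2 (h2 k hk)

open Classical in
theorem erasureRate_eq (F : Type*) [Field F] [Fintype F] (ε : ℝ) (n : ℕ) (i : Idx F n) :
    erasureRate F ε n i =
      ∑ E : Finset (Pos F n), if IsErased 0 E i then patternProb F ε E else 0 := by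
  have h : ∀ u : Idx F n → F,
      (∑ E : Finset (Pos F n), if IsErased u E i then patternProb F ε E else 0) =
        ∑ E : Finset (Pos F n), if IsErased 0 E i then patternProb F ε E else 0 := fun u =>
    sum_congr rfl fun E _ => if_congr (by rw [isErased_iff, isErased_iff]) rfl rfl
  rw [erasureRate, sum_congr rfl fun u _ => h u, sum_const, card_univ, nsmul_eq_mul,
    mul_div_cancel_left₀]
  exact_mod_cast Fintype.card_ne_zero

theorem toLex_cons_lt_of_lt {n q : ℕ} {a b : Fin q} (h : a < b) (j k : Fin n → Fin q) :
    toLex (Fin.cons a j : Fin (n + 1) → Fin q) < toLex (Fin.cons b k : Fin (n + 1) → Fin q) :=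
  ⟨0, fun t ht => absurd ht (Fin.not_lt_zero t), h⟩

theorem toLex_cons_lt_cons {n q : ℕ} (a : Fin q) {j k : Fin n → Fin q}
    (h : toLex j < toLex k) :
    toLex (Fin.cons a j : Fin (n + 1) → Fin q) < toLex (Fin.cons a k : Fin (n + 1) → Fin q) := by
  obtain ⟨t, h1, h2⟩ := h
  refine ⟨t.succ, fun s hs => ?_, h2⟩
  induction s using Fin.cases with
  | zero => rfl
  | succ s => exact h1 s (Fin.succ_lt_succ_iff.1 hs)

/-- The Kronecker recursion: for fixed `k`, the symbols at `(a, k)` form one kernel codeword, whose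
inputs are the `k`-th symbols of `q` shorter codewords. -/
theorem encode_cons {F : Type*} [Field F] [Fintype F] {n : ℕ} (v : Idx F (n + 1) → F) (a : F)
    (k : Pos F n) :
    encode v (Fin.cons a k : Pos F (n + 1)) =
      ∑ m : Fin (Fintype.card F), kernel F m a * encode (fun j : Idx F n => v (Fin.cons m j)) k := by
  simp only [encode, Matrix.vecMul, dotProduct]
  rw [← (Fin.consEquiv fun _ => Fin (Fintype.card F)).sum_comp, Fintype.sum_prod_type]
  refine sum_congr rfl fun m _ => ?_
  rw [mul_sum]
  refine sum_congr rfl fun j _ => ?_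
  simp only [Fin.consEquiv, Equiv.coe_fn_mk, transform, Fin.prod_univ_succ, Fin.cons_zero,
    Fin.cons_succ]
  ring

/-- A combination of the kernel rows from `m` on is a polynomial of degree at most `q - 1 - m`, so
the coefficient of row `m` vanishes as soon as there are more than `q - 1 - m` zeros. -/
theorem coeff_eq_zero_of_kernel_sum_eq_zero {F : Type*} [Field F] [Fintype F]
    (w : Fin (Fintype.card F) → F) (m : Fin (Fintype.card F)) (hw : ∀ j, j < m → w j = 0)
    (s : Finset F) (hs : ∀ a ∈ s, ∑ j, kernel F j a * w j = 0)
    (hcard : Fintype.card F - 1 - m < s.card) : w m = 0 := by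
  set p : Polynomial F :=
    ∑ j : Fin (Fintype.card F), Polynomial.monomial (Fintype.card F - 1 - (j : ℕ)) (w j) with hp
  have hdeg : p.natDegree ≤ Fintype.card F - 1 - m := by
    refine Polynomial.natDegree_sum_le_of_forall_le _ _ fun j _ => ?_
    rcases lt_or_ge j m with h | h
    · simp [hw j h]
    · refine (Polynomial.natDegree_monomial_le _).trans ?_
      have : (m : ℕ) ≤ j := h
      omega
  have hzero : p = 0 := by
    refine Polynomial.eq_zero_of_natDegree_lt_card_of_eval_eq_zero' p s (fun a ha => ?_)
      (hdeg.trans_lt hcard)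
    rw [hp, Polynomial.eval_finsetSum, ← hs a ha]
    refine sum_congr rfl fun j _ => ?_
    rw [Polynomial.eval_monomial, kernel, mul_comm]
  have hcoeff : p.coeff (Fintype.card F - 1 - m) = w m := by
    rw [hp, Polynomial.finsetSum_coeff, sum_eq_single m]
    · simp
    · intro j _ hj
      rw [Polynomial.coeff_monomial, if_neg]
      intro h
      exact hj (Fin.ext (by omega))
    · simp
  rw [← hcoeff, hzero, Polynomial.coeff_zero]

/-! ### Reduction of erasure patterns through the kernel. -/

open Classical in
/-- The erased symbols among those whose position has tail `k`. -/
noncomputable def fiberErasures {F : Type*} [Field F] [Fintype F] {n : ℕ}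
    (E : Finset (Pos F (n + 1))) (k : Pos F n) : Finset F :=
  univ.filter fun a => (Fin.cons a k : Pos F (n + 1)) ∈ E

open Classical in
/-- The positions that stay erased after decoding the kernel at its row `m`. -/
noncomputable def reducePattern {F : Type*} [Field F] [Fintype F] {n : ℕ} (m : ℕ)
    (E : Finset (Pos F (n + 1))) : Finset (Pos F n) :=
  univ.filter fun k => m < (fiberErasures E k).card

/-- Take an ambiguity witness `v`. Where a fiber has at most `i 0` erasures, the kernel codeword
over it has enough zeros to kill the input at row `i 0`. The block of `v` with first digit `i 0` is
therefore a witness for the reduced pattern. The converse is not needed, as only upper bounds on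
erasure rates are used. -/
theorem IsErased.reducePattern {F : Type*} [Field F] [Fintype F] {n : ℕ}
    {E : Finset (Pos F (n + 1))} {i : Idx F (n + 1)} (h : IsErased 0 E i) :
    IsErased 0 (reducePattern (i 0) E) (Fin.tail i) := by
  classical
  rw [isErased_iff] at h ⊢
  obtain ⟨v, h1, h2, h3⟩ := h
  have hi : (Fin.cons (i 0) (Fin.tail i) : Fin (n + 1) → Fin (Fintype.card F)) = i :=
    Fin.cons_self_tail i
  refine ⟨fun j => v (Fin.cons (i 0) j), fun j hj => h1 _ ?_, fun k hk => ?_, ?_⟩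
  · have := toLex_cons_lt_cons (i 0) hj
    rwa [hi] at this
  · have hk : (fiberErasures E k).card ≤ i 0 := by
      simpa [RSPolar.reducePattern] using hk
    refine coeff_eq_zero_of_kernel_sum_eq_zero
      (fun m => encode (fun j : Idx F n => v (Fin.cons m j)) k) (i 0) (fun m hm => ?_)
      (fiberErasures E k)ᶜ (fun a ha => ?_) ?_
    · have : (fun j : Idx F n => v (Fin.cons m j)) = 0 := funext fun j => h1 _ (by
        have := toLex_cons_lt_of_lt hm j (Fin.tail i)
        rwa [hi] at this)
      simp [this, encode]
    · rw [← encode_cons]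
      exact h2 _ (by simpa [fiberErasures] using ha)
    -- At least `q - i 0` unerased points, one more than the degree bound `q - 1 - i 0`.
    · rw [card_compl]
      have := (i 0).isLt
      omega
  · simpa only [hi] using h3

open Classical in
/-- An erasure pattern of length `q ^ (n + 1)` is a family of `q ^ n` patterns of length `q`. -/
noncomputable def sectionEquiv (F : Type*) [Field F] [Fintype F] (n : ℕ) :
    Finset (Pos F (n + 1)) ≃ (Pos F n → Finset F) where
  toFun := fiberErasures
  invFun S := univ.filter fun k => k 0 ∈ S (Fin.tail k)
  left_inv E := by
    ext k
    simp [fiberErasures]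
  right_inv S := by
    ext k a
    simp [fiberErasures]

theorem card_eq_sum_card_section {F : Type*} [Field F] [Fintype F] {n : ℕ}
    (E : Finset (Pos F (n + 1))) : E.card = ∑ k, (fiberErasures E k).card := by
  classical
  simp only [fiberErasures, card_filter]
  rw [← Fintype.sum_prod_type_right fun p : F × Pos F n =>
      if (Fin.cons p.1 p.2 : Pos F (n + 1)) ∈ E then 1 else 0]
  exact (by simp : E.card = ∑ k, if k ∈ E then 1 else 0).trans
    ((Fin.consEquiv fun _ => F).sum_comp fun k => if k ∈ E then 1 else 0).symm

theorem patternProb_eq_prod {F : Type*} [Field F] [Fintype F] {n : ℕ} (ε : ℝ)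
    (E : Finset (Pos F (n + 1))) :
    patternProb F ε E = ∏ k, ε ^ (fiberErasures E k).card *
      (1 - ε) ^ (Fintype.card F - (fiberErasures E k).card) := by
  rw [prod_mul_distrib, prod_pow_eq_pow_sum, prod_pow_eq_pow_sum, ← card_eq_sum_card_section,
    sum_tsub_distrib _ fun k _ => card_le_univ _, ← card_eq_sum_card_section, patternProb]
  simp [pow_succ]

theorem sum_binomialTail_finset (α : Type*) [Fintype α] (m : ℕ) (x : ℝ) :
    (∑ S : Finset α, if m < S.card then x ^ S.card * (1 - x) ^ (Fintype.card α - S.card) else 0) =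
      binomialTail (Fintype.card α) m x := by
  rw [← powerset_univ, sum_powerset_apply_card fun k =>
    if m < k then x ^ k * (1 - x) ^ (Fintype.card α - k) else 0, card_univ, binomialTail]
  refine sum_congr rfl fun k _ => ?_
  split_ifs <;> simp [binomialWeight]

theorem sum_one_sub_binomialTail_finset (α : Type*) [Fintype α] (m : ℕ) (x : ℝ) :
    (∑ S : Finset α, if m < S.card then 0 else x ^ S.card * (1 - x) ^ (Fintype.card α - S.card)) =
      1 - binomialTail (Fintype.card α) m x := by
  have h : ∑ S : Finset α, x ^ S.card * (1 - x) ^ (Fintype.card α - S.card) = 1 := by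
    rw [Fintype.sum_pow_mul_eq_add_pow]
    simp
  rw [eq_sub_iff_add_eq, ← sum_binomialTail_finset, ← sum_add_distrib]
  refine Eq.trans ?_ h
  refine sum_congr rfl fun S _ => ?_
  split_ifs <;> simp

open Classical in
/-- Under the reduction at row `m` the erasure channel with erasure probability `ε` becomes the
erasure channel whose erasure probability is the binomial tail. -/
theorem sum_patternProb_reducePattern_eq {F : Type*} [Field F] [Fintype F] {n : ℕ} (m : ℕ) (ε : ℝ)
    (T : Finset (Pos F n)) :
    (∑ E : Finset (Pos F (n + 1)), if reducePattern m E = T then patternProb F ε E else 0) =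
      patternProb F (binomialTail (Fintype.card F) m ε) T := by
  set w : Finset F → ℝ := fun S => ε ^ S.card * (1 - ε) ^ (Fintype.card F - S.card) with hw
  -- `reducePattern m E = T` is a separate condition on each fiber, so the sum factors: this is the
  -- independence of the fibers.
  calc (∑ E : Finset (Pos F (n + 1)), if reducePattern m E = T then patternProb F ε E else 0)
      = ∑ E : Finset (Pos F (n + 1)), ∏ k : Pos F n,
          if (m < (sectionEquiv F n E k).card ↔ k ∈ T) then w (sectionEquiv F n E k) else 0 := by
        refine sum_congr rfl fun E _ => ?_
        rw [prod_ite_zero, patternProb_eq_prod]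
        have hiff : reducePattern m E = T ↔
            ∀ k ∈ univ, (m < (sectionEquiv F n E k).card ↔ k ∈ T) := by
          simp [reducePattern, Finset.ext_iff, sectionEquiv]
        by_cases h : reducePattern m E = T
        · rw [if_pos h, if_pos (hiff.1 h)]
          rfl
        · rw [if_neg h, if_neg fun h' => h (hiff.2 h')]
    _ = ∑ S : Pos F n → Finset F, ∏ k : Pos F n,
          if (m < (S k).card ↔ k ∈ T) then w (S k) else 0 :=
        (sectionEquiv F n).sum_comp fun S => ∏ k : Pos F n,
          if (m < (S k).card ↔ k ∈ T) then w (S k) else 0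
    _ = ∏ k : Pos F n, ∑ S : Finset F, if (m < S.card ↔ k ∈ T) then w S else 0 := by
        rw [prod_univ_sum, Fintype.piFinset_univ]
    _ = ∏ k : Pos F n, if k ∈ T then binomialTail (Fintype.card F) m ε else
          1 - binomialTail (Fintype.card F) m ε := by
        refine prod_congr rfl fun k _ => ?_
        by_cases hk : k ∈ T
        · simp only [hk, iff_true, if_true]
          exact sum_binomialTail_finset F m ε
        · simp only [hk, iff_false, if_false, ite_not]
          exact sum_one_sub_binomialTail_finset F m ε
    _ = _ := by
        rw [prod_ite, prod_const, prod_const, patternProb]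
        congr 2
        · simp
        · have : (univ.filter fun k => k ∉ T) = Tᶜ := by
            ext
            simp
          rw [this, card_compl]
          simp

theorem patternProb_nonneg {F : Type*} [Field F] [Fintype F] {n : ℕ} {ε : ℝ} (h0 : 0 ≤ ε)
    (h1 : ε ≤ 1) (E : Finset (Pos F n)) : 0 ≤ patternProb F ε E := by
  have : 0 ≤ 1 - ε := by linarith
  unfold patternProb
  positivity

theorem erasureRate_succ_le (F : Type*) [Field F] [Fintype F] {ε : ℝ} (h0 : 0 ≤ ε) (h1 : ε ≤ 1)
    (n : ℕ) (i : Idx F (n + 1)) :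
    erasureRate F ε (n + 1) i ≤
      erasureRate F (binomialTail (Fintype.card F) (i 0) ε) n (Fin.tail i) := by
  classical
  rw [erasureRate_eq, erasureRate_eq]
  calc _ ≤ ∑ E : Finset (Pos F (n + 1)),
          if IsErased 0 (reducePattern (i 0) E) (Fin.tail i) then patternProb F ε E else 0 := by
        refine sum_le_sum fun E _ => ?_
        by_cases h : IsErased 0 E i
        · rw [if_pos h, if_pos h.reducePattern]
        · rw [if_neg h]
          split_ifs
          exacts [patternProb_nonneg h0 h1 E, le_rfl]
    _ = ∑ E : Finset (Pos F (n + 1)), ∑ T : Finset (Pos F n),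
          if reducePattern (i 0) E = T then
            (if IsErased 0 T (Fin.tail i) then patternProb F ε E else 0) else 0 := by
        refine sum_congr rfl fun E _ => ?_
        rw [sum_ite_eq, if_pos (mem_univ _)]
    _ = _ := by
        rw [sum_comm]
        refine sum_congr rfl fun T _ => ?_
        rw [← sum_patternProb_reducePattern_eq]
        split_ifs <;> simp

theorem erasureRate_zero_le (F : Type*) [Field F] [Fintype F] {ε : ℝ} (h0 : 0 ≤ ε)
    (i : Idx F 0) : erasureRate F ε 0 i ≤ ε := by
  classical
  rw [erasureRate_eq, sum_eq_single univ]
  · split_ifs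
    · simp [patternProb]
    · exact h0
  · intro E _ hE
    rw [if_neg]
    rw [isErased_iff]
    rintro ⟨v, -, h2, h3⟩
    obtain ⟨k, hk⟩ : ∃ k, k ∉ E := by
      by_contra! h
      exact hE (eq_univ_iff_forall.2 h)
    have := h2 k hk
    simp only [encode, Matrix.vecMul, dotProduct, transform, univ_eq_empty, prod_empty, mul_one,
      univ_unique, sum_singleton] at this
    exact h3 ((congrArg v (Subsingleton.elim _ _)).trans this)
  · simp

/-! ### The tail process and the count of good channels. -/

/-- The erasure probability that evolves from `x` by passing to the tail of a binomial variable at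
each of the `n` steps, at the level given by the digits of `i`. -/
noncomputable def tailProcess (q : ℕ) : (n : ℕ) → ℝ → (Fin n → Fin q) → ℝ
  | 0, x, _ => x
  | n + 1, x, i => tailProcess q n (binomialTail q (i 0) x) (Fin.tail i)

theorem tailProcess_mem_Icc (q n : ℕ) {x : ℝ} (h0 : 0 ≤ x) (h1 : x ≤ 1) (i : Fin n → Fin q) :
    0 ≤ tailProcess q n x i ∧ tailProcess q n x i ≤ 1 := by
  induction n generalizing x with
  | zero => exact ⟨h0, h1⟩
  | succ n ih =>
    exact ih (binomialTail_nonneg q _ h0 h1) (binomialTail_le_one q _ h0 h1) (Fin.tail i)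

theorem erasureRate_le_tailProcess (F : Type*) [Field F] [Fintype F] {ε : ℝ} (h0 : 0 ≤ ε)
    (h1 : ε ≤ 1) (n : ℕ) (i : Idx F n) :
    erasureRate F ε n i ≤ tailProcess (Fintype.card F) n ε i := by
  induction n generalizing ε with
  | zero => exact erasureRate_zero_le F h0 i
  | succ n ih =>
    exact (erasureRate_succ_le F h0 h1 n i).trans
      (ih (binomialTail_nonneg _ _ h0 h1) (binomialTail_le_one _ _ h0 h1) (Fin.tail i))

theorem sum_tailProcess_succ (q n : ℕ) (x : ℝ) (g : ℝ → ℝ) :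
    ∑ i, g (tailProcess q (n + 1) x i) =
      ∑ m ∈ range q, ∑ i, g (tailProcess q n (binomialTail q m x) i) := by
  rw [← (Fin.consEquiv fun _ => Fin q).sum_comp, Fintype.sum_prod_type,
    sum_range fun m => ∑ i, g (tailProcess q n (binomialTail q m x) i)]
  rfl

theorem sum_tailProcess (q n : ℕ) (x : ℝ) : ∑ i, tailProcess q n x i = (q : ℝ) ^ n * x := by
  induction n generalizing x with
  | zero => simp [tailProcess]
  | succ n ih =>
    rw [sum_tailProcess_succ q n x fun y => y, sum_congr rfl fun m _ => ih _, ← mul_sum,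
      sum_binomialTail]
    ring

theorem sum_potential_tailProcess_le {β : ℝ} {q : ℕ} {c : ℝ} (hc : 0 ≤ c)
    (hstep : ∀ x : ℝ, 0 ≤ x → x ≤ 1 →
      ∑ m ∈ range q, potential β (binomialTail q m x) ≤ c * potential β x)
    (n : ℕ) {x : ℝ} (h0 : 0 ≤ x) (h1 : x ≤ 1) :
    ∑ i, potential β (tailProcess q n x i) ≤ c ^ n * potential β x := by
  induction n generalizing x with
  | zero => simp [tailProcess]
  | succ n ih =>
    rw [sum_tailProcess_succ q n x (potential β)]
    calc _ ≤ ∑ m ∈ range q, c ^ n * potential β (binomialTail q m x) :=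
          sum_le_sum fun m _ => ih (binomialTail_nonneg _ _ h0 h1) (binomialTail_le_one _ _ h0 h1)
      _ ≤ c ^ n * (c * potential β x) := by
          rw [← mul_sum]
          gcongr
          exact hstep x h0 h1
      _ = _ := by ring

/-- The second term is `(z / η)^β * (1 - z)^β`, at least `1 - z`. Pairing it with `z` accounts for
the values near 1, where the potential is small. -/
theorem one_le_add_potential {β η z : ℝ} (hβ0 : 0 < β) (hβ1 : β ≤ 1) (hη : 0 < η) (hz : η < z)
    (hz1 : z ≤ 1) : 1 ≤ z + η ^ (-β) * potential β z := by
  have hz0 : 0 < z := hη.trans hz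
  have h1 : 1 - z ≤ (1 - z) ^ β := by
    rcases hz1.eq_or_lt with h | h
    · rw [h, sub_self, Real.zero_rpow hβ0.ne']
    · simpa using Real.rpow_le_rpow_of_exponent_ge (x := 1 - z) (by linarith) (by linarith) hβ1
  have h2 : 1 ≤ η ^ (-β) * z ^ β := by
    rw [Real.rpow_neg hη.le, ← div_eq_inv_mul, one_le_div (by positivity)]
    exact Real.rpow_le_rpow hη.le hz.le hβ0.le
  have h3 : 0 ≤ (1 - z) ^ β := Real.rpow_nonneg (by linarith) _
  rw [potential, Real.mul_rpow hz0.le (by linarith), ← mul_assoc]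
  nlinarith

/-- Markov's inequality for the potential, combined with the conservation of the mean. -/
theorem le_fractionAtMost {F : Type*} [Field F] [Fintype F] {ε : ℝ} (h0 : 0 ≤ ε) (h1 : ε ≤ 1)
    {β : ℝ} (hβ0 : 0 < β) (hβ1 : β ≤ 1) {η : ℝ} (hη : 0 < η) (n : ℕ) :
    1 - ε - η ^ (-β) * ((∑ i, potential β (tailProcess (Fintype.card F) n ε i)) /
      (Fintype.card F : ℝ) ^ n) ≤ fractionAtMost F ε n η := by
  classical
  set q := Fintype.card F with hq
  have hq0 : (0 : ℝ) < (q : ℝ) ^ n := by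
    have : 0 < q := Fintype.card_pos
    positivity
  have hcount : (q : ℝ) ^ n ≤ (univ.filter fun i : Idx F n => erasureRate F ε n i ≤ η).card +
      ((q : ℝ) ^ n * ε + η ^ (-β) * ∑ i, potential β (tailProcess q n ε i)) := by
    calc (q : ℝ) ^ n = ∑ _i : Idx F n, (1 : ℝ) := by simp [hq]
      _ ≤ ∑ i : Idx F n, ((if erasureRate F ε n i ≤ η then 1 else 0) +
            (tailProcess q n ε i + η ^ (-β) * potential β (tailProcess q n ε i))) := by
          refine sum_le_sum fun i _ => ?_
          obtain ⟨hz0, hz1⟩ := tailProcess_mem_Icc q n h0 h1 i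
          have hp := potential_nonneg β hz0 hz1
          split_ifs with h
          · have : 0 ≤ η ^ (-β) * potential β (tailProcess q n ε i) := by positivity
            linarith
          · rw [zero_add]
            exact one_le_add_potential hβ0 hβ1 hη
              ((not_le.1 h).trans_le (erasureRate_le_tailProcess F h0 h1 n i)) hz1
      _ = _ := by
          rw [sum_add_distrib, sum_add_distrib, sum_boole, ← mul_sum, sum_tailProcess]
  rw [fractionAtMost, le_div_iff₀ hq0, sub_mul, sub_mul, mul_assoc, div_mul_cancel₀ _ hq0.ne']
  linarith

end RSPolar

/-! ### Choice of parameters. -/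

open RSPolar

theorem mainTheorem2 (ε : ℝ) (hε₀ : 0 ≤ ε) (hε₁ : ε ≤ 1)
    (γ : ℝ) (hγ : 0 < γ) (δ : ℝ) (hδ : 0 < δ) :
    ∃ β : ℝ, 0 < β ∧ β ≤ 1 / 2 ∧ ∃ q₀ : ℕ,
      ∀ q : ℕ, IsPrimePow q → q₀ ≤ q →
      ∀ (F : Type*) [Field F] [Fintype F], Fintype.card F = q →
      ∀ (n : ℕ) (N : ℝ), N = (q : ℝ) ^ n →
        1 - ε - 5 * N ^ (-(1 / 2 : ℝ) + δ) ≤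
          RSPolar.fractionAtMost F ε n (N ^ (-γ)) := by
  -- The bound `1/2` serves the contraction; `δ / (2 * γ)` limits the Markov loss `N^(γβ)` to
  -- `N^(δ/2)`.
  have hβ0 : 0 < min (1 / 2) (δ / (2 * γ)) := lt_min (by norm_num) (by positivity)
  refine ⟨min (1 / 2) (δ / (2 * γ)), hβ0, min_le_left _ _, ?_⟩
  have hβ1 : min (1 / 2) (δ / (2 * γ)) ≤ 1 / 2 := min_le_left _ _
  have hβγ : γ * min (1 / 2) (δ / (2 * γ)) ≤ δ / 2 := by
    calc γ * min (1 / 2) (δ / (2 * γ)) ≤ γ * (δ / (2 * γ)) := by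
          gcongr
          exact min_le_right _ _
      _ = δ / 2 := by field_simp
  generalize min (1 / 2) (δ / (2 * γ)) = β at hβ0 hβ1 hβγ
  obtain ⟨C, hC, hstep⟩ := exists_sum_potential_binomialTail_le hβ0 hβ1
  -- `C` depends only on `β`, so a large `q` absorbs it into `q^(δ/2)`, uniformly in `n`.
  obtain ⟨q₀, hq₀⟩ := Filter.eventually_atTop.1
    (((tendsto_rpow_atTop (half_pos hδ)).comp tendsto_natCast_atTop_atTop).eventually_ge_atTop C)
  refine ⟨q₀, ?_⟩
  rintro q hq hqq F _ _ rfl n N rfl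
  have hCq : C ≤ (Fintype.card F : ℝ) ^ (δ / 2) := hq₀ _ hqq
  have hmain := fun η hη => le_fractionAtMost (F := F) hε₀ hε₁ hβ0 (by linarith) (η := η) hη n
  generalize Fintype.card F = q at hq hCq hmain ⊢
  have hq1 : 1 ≤ q := hq.one_lt.le
  have hq1' : (1 : ℝ) ≤ q := by exact_mod_cast hq1
  have hqpos : (0 : ℝ) < q := by linarith
  set c : ℝ := (q : ℝ) ^ (1 / 2 + δ / 2) with hc
  have hsum := sum_potential_tailProcess_le (β := β) (q := q) (c := c) (by positivity)
    (fun x h0 h1 => (hstep q hq1 x h0 h1).trans (by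
      have := potential_nonneg β h0 h1
      rw [hc, add_comm, Real.rpow_add hqpos]
      gcongr)) n hε₀ hε₁
  set N : ℝ := (q : ℝ) ^ n with hN
  have hN1 : 1 ≤ N := one_le_pow₀ hq1'
  have hN0 : 0 < N := by linarith
  have hcn : c ^ n = N ^ (1 / 2 + δ / 2) := by
    rw [hc, hN, ← Real.rpow_natCast, ← Real.rpow_natCast, ← Real.rpow_mul hqpos.le,
      ← Real.rpow_mul hqpos.le, mul_comm]
  refine le_trans ?_ (hmain (N ^ (-γ)) (by positivity))
  have hbound : (N ^ (-γ)) ^ (-β) * ((∑ i, potential β (tailProcess q n ε i)) / N) ≤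
      N ^ (-(1 / 2 : ℝ) + δ) := by
    calc (N ^ (-γ)) ^ (-β) * ((∑ i, potential β (tailProcess q n ε i)) / N)
        ≤ (N ^ (-γ)) ^ (-β) * (N ^ (1 / 2 + δ / 2) / N) := by
          gcongr
          rw [← hcn]
          exact hsum.trans (mul_le_of_le_one_right (by positivity)
            (potential_le_one hβ0.le hε₀ hε₁))
      _ = N ^ (γ * β + (1 / 2 + δ / 2 - 1)) := by
          rw [← Real.rpow_mul hN0.le, ← Real.rpow_sub_one hN0.ne', ← Real.rpow_add hN0]
          congr 1
          ring
      _ ≤ _ := Real.rpow_le_rpow_of_exponent_le hN1 (by linarith)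
  -- The bound holds with constant 1; it is weakened to 5 here.
  have : 0 ≤ N ^ (-(1 / 2 : ℝ) + δ) := by positivity
  linarith
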